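/- **Setting.** Let $\nu_X,\nu_Y$ be $\sigma$-finite measures on measurable spaces $\Omega_X,\Omega_Y$, and let $(X,Y)$ have joint distribution $P$ with a positive measurable density $p$ with respect to $\nu_X\times\nu_Y$. Let $x^\circ\in\Omega_X$, let $y_0,\dots,y_K\in\Omega_Y$ be distinct values with $\int p(x,y_k)\,d\nu_X(x)<\infty$, and let $y_0$ serve as reference value. Consider the association model $\psi_\theta(x,y)=G(h_X(x),h_Y(y),\theta)$, $\theta\in\mathbb R^S$, where $h_X:\Omega_X\to\mathbb R^{d_X}$ and $h_Y:\Omega_Y\to\mathbb R^{d_Y}$ are measurable with $h_X(x^\circ)=0$, $h_Y(y_0)=0$, each $\psi_\theta$ is measurable, $G(0,\cdot,\cdot)=G(\cdot,0,\cdot)=0$, and $G(z,v,\theta)$ is three times continuously differentiable in $\theta$ for all $z\in h_X[\Omega_X]$, $v\in h_Y[\Omega_Y]$, with derivatives continuous in $(z,v)$. The true parameter $\theta^\circ\in\mathbb R^S$ satisfies $$\log\frac{p(x,y)\,p(x^\circ,y_0)}{p(x,y_0)\,p(x^\circ,y)}=\psi_{\theta^\circ}(x,y)\qquad\text{for all }x,y.$$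 **Sampling.** Let $X_{ki}$ ($k=0,\dots,K$, $i\ge1$) be independent, $X_{ki}\sim X_k\sim\mathcal L(X\mid Y=y_k)$, the distribution with $\nu_X$-density $p(x\mid Y=y_k)=p(x,y_k)/\int p(x',y_k)\,d\nu_X(x')$. Of these the first $n_k$ are observed for each $k$; the total size $n=\sum_k n_k$ tends to infinity while the ratios $\bar r_k=n_k/n>0$ stay fixed. For $\lambda=(\theta,\gamma)\in\mathbb R^{S+K}$ and $\gamma_0:=0$ put $$p_k^*(x)=p_k^*(x\mid\lambda)=\frac{\exp[\gamma_k+\psi_\theta(x,y_k)]}{\sum_{l=0}^K\exp[\gamma_l+\psi_\theta(x,y_l)]},\qquad \ell^{(n)}(\lambda)=\sum_{k=0}^K\sum_{i=1}^{n_k}\log p_k^*(X_{ki}\mid\lambda),\qquad J^{(n)}(\lambda)=-D^2_{\lambda\lambda}\ell^{(n)}(\lambda),$$ and let $\lambda^\circ=(\theta^\circ,\gamma^\circ)$ with $\gamma_k^\circ=\log\dfrac{\bar r_k\,p(x^\circ\mid Y=y_k)}{\bar r_0\,p(x^\circ\mid Y=y_0)}$ for $k=1,\dots,K$ (so that $p_k^*(x\mid\lambda^\circ)=\bar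 r_k\,p(x\mid Y=y_k)/\sum_l\bar r_l\,p(x\mid Y=y_l)$). Assume that for each $k$ the first partial derivatives $D_{\lambda_s}\log p_k^*(X_k)$ at $\lambda^\circ$ are square integrable and the second partial derivatives $D^2_{\lambda_s\lambda_t}\log p_k^*(X_k)$ at $\lambda^\circ$ are integrable, and put $$\bar I=\sum_{k=0}^K\bar r_k\,E\bigl(-D^2_{\lambda\lambda}\log p_k^*(X_k)\bigr)\Big|_{\lambda=\lambda^\circ},\qquad \bar\Sigma=\sum_{k=0}^K\bar r_k\,\mathrm{Cov}\bigl(D_\lambda\log p_k^*(X_k)\bigr)\Big|_{\lambda=\lambda^\circ}.$$ Assume that $\bar I$ is positive definite. **Theorem 5 (Normality).** Let $\hat\lambda^{(n)}=(\hat\theta^{(n)},\hat\gamma^{(n)})$ be any sequence of (measurable) estimators such that - (N1) $n^{-1/2}D_\lambda\ell^{(n)}(\hat\lambda^{(n)})\to0$ in probability, - (N2) $\hat\lambda^{(n)}\to\lambda^\circ$ in probability, - (N3) $\frac1n\int_0^1J^{(n)}\bigl(\lambda^\circ+t[\hat\lambda^{(n)}-\lambda^\circ]\bigr)dt\to\bar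 I$ in probability. Then, as $n\to\infty$, - (a) $\sqrt n\,[\hat\lambda^{(n)}-\lambda^\circ]\xrightarrow{\mathcal L}N\bigl(0,\bar I^{-1}\bar\Sigma\bar I^{-1}\bigr)$; - (b) $\sqrt n\,[\hat\theta^{(n)}-\theta^\circ]\xrightarrow{\mathcal L}N\bigl(0,[\bar I^{-1}]_{\theta\theta}\bigr)$, where $[\,\cdot\,]_{\theta\theta}$ is the $S\times S$ block belonging to $\theta$. -/

import Mathlib

open MeasureTheory ProbabilityTheory Filter Topology
open scoped ENNReal

namespace OddsRatio

noncomputable section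

/-- The association parameter `θ ∈ ℝ^S`. -/
abbrev Theta (S : ℕ) := EuclideanSpace ℝ (Fin S)

/-- The compound parameter `λ = (θ, γ) ∈ ℝ^(S+K)`. -/
abbrev Param (S K : ℕ) := EuclideanSpace ℝ (Fin S ⊕ Fin K)

variable {ΩX ΩY Ω : Type*}

/-- The log-odds ratio function of a positive density `p` with respect to the reference
values `x₀`, `y₀`. -/
def logOddsRatio (p : ΩX → ΩY → ℝ) (x₀ : ΩX) (y₀ : ΩY) (x : ΩX) (y : ΩY) : ℝ :=
  Real.log ((p x y * p x₀ y₀) / (p x y₀ * p x₀ y))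

/-- `ψ_θ(x, y) = G(h_X(x), h_Y(y), θ)`. -/
def psi {dX dY S : ℕ} (hX : ΩX → EuclideanSpace ℝ (Fin dX)) (hY : ΩY → EuclideanSpace ℝ (Fin dY))
    (G : EuclideanSpace ℝ (Fin dX) → EuclideanSpace ℝ (Fin dY) → Theta S → ℝ)
    (θ : Theta S) (x : ΩX) (y : ΩY) : ℝ :=
  G (hX x) (hY y) θ

/-- The standing conditions on the functions `h_X`, `h_Y`, `G` of an association model
with reference values `x₀`, `y₀`. -/
structure IsAssociationModel [MeasurableSpace ΩX] [MeasurableSpace ΩY] {dX dY S : ℕ}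
    (hX : ΩX → EuclideanSpace ℝ (Fin dX)) (hY : ΩY → EuclideanSpace ℝ (Fin dY))
    (G : EuclideanSpace ℝ (Fin dX) → EuclideanSpace ℝ (Fin dY) → Theta S → ℝ)
    (x₀ : ΩX) (y₀ : ΩY) : Prop where
  measurable_hX : Measurable hX
  measurable_hY : Measurable hY
  hX_ref : hX x₀ = 0
  hY_ref : hY y₀ = 0
  zero_left : ∀ v ∈ Set.range hY, ∀ θ, G 0 v θ = 0
  zero_right : ∀ z ∈ Set.range hX, ∀ θ, G z 0 θ = 0
  measurable_psi : ∀ θ, Measurable (fun q : ΩX × ΩY => psi hX hY G θ q.1 q.2)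
  contDiff : ∀ z ∈ Set.range hX, ∀ v ∈ Set.range hY, ContDiff ℝ 3 (G z v)
  continuousOn_deriv : ∀ (θ : Theta S) (j : ℕ), 1 ≤ j → j ≤ 3 →
    ContinuousOn
      (fun q : EuclideanSpace ℝ (Fin dX) × EuclideanSpace ℝ (Fin dY) =>
        iteratedFDeriv ℝ j (G q.1 q.2) θ)
      (Set.range hX ×ˢ Set.range hY)

/-- The conditional density `p(x | Y = y) = p(x, y) / ∫ p(x', y) dν_X(x')`. -/
def condDensity [MeasurableSpace ΩX] (νX : Measure ΩX) (p : ΩX → ΩY → ℝ) (y : ΩY) (x : ΩX) : ℝ :=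
  p x y / ∫ x', p x' y ∂νX

/-- The conditional distribution `𝓛(X | Y = y)`. -/
def condLaw [MeasurableSpace ΩX] (νX : Measure ΩX) (p : ΩX → ΩY → ℝ) (y : ΩY) : Measure ΩX :=
  νX.withDensity (fun x => ENNReal.ofReal (condDensity νX p y x))

/-- The parameter `γ = (γ_1, …, γ_K)`, extended by `γ_0 = 0`. -/
def gammaExt {S K : ℕ} (lam : Param S K) : Fin (K + 1) → ℝ :=
  Fin.cons 0 (fun j : Fin K => lam (Sum.inr j))

/-- The part `θ` of `λ = (θ, γ)`. -/
def thetaPart {S K : ℕ} (lam : Param S K) : Theta S :=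
  WithLp.toLp 2 (fun s => lam (Sum.inl s))

/-- The true parameter `λ° = (θ°, γ°)`, where
`γ°_k = log (r_k p(x₀ | Y = y_k) / (r_0 p(x₀ | Y = y_0)))`. With `r_k` as marginal probabilities
of the values `y_k` and `p(· | Y = y_k)` as conditional densities, the conditional probability of
`y_k` given `X = x` is then proportional in `k` to `exp (γ°_k + ψ_θ°(x, y_k))`. -/
def trueParam [MeasurableSpace ΩX] {S K : ℕ} (νX : Measure ΩX) (p : ΩX → ΩY → ℝ)
    (x₀ : ΩX) (y : Fin (K + 1) → ΩY) (r : Fin (K + 1) → ℝ) (θ₀ : Theta S) : Param S K :=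
  WithLp.toLp 2 (Sum.elim (fun s => θ₀ s) (fun j : Fin K =>
    Real.log ((r j.succ * condDensity νX p (y j.succ) x₀) / (r 0 * condDensity νX p (y 0) x₀))))

/-- `log p*_k(x)` as a function of `λ`:
`γ_k + ψ_θ(x, y_k) - log ∑_l exp (γ_l + ψ_θ(x, y_l))`. -/
def logProb {S K : ℕ} (ψ : Theta S → ΩX → ΩY → ℝ) (y : Fin (K + 1) → ΩY) (k : Fin (K + 1))
    (x : ΩX) (lam : Param S K) : ℝ :=
  gammaExt lam k + ψ (thetaPart lam) x (y k)
    - Real.log (∑ l, Real.exp (gammaExt lam l + ψ (thetaPart lam) x (y l)))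

/-- The conditional log-likelihood `ℓ(λ)` of the subsamples `X_{k,1}, …, X_{k,n_k}`; the
observations are numbered from `0`. -/
def logLik {S K : ℕ} (ψ : Theta S → ΩX → ΩY → ℝ) (y : Fin (K + 1) → ΩY) (n : Fin (K + 1) → ℕ)
    (X : Fin (K + 1) → ℕ → ΩX) (lam : Param S K) : ℝ :=
  ∑ k, ∑ i ∈ Finset.range (n k), logProb ψ y k (X k i) lam

/-- The partial derivative `D_{λ_s} f`. -/
def pderiv {S K : ℕ} (s : Fin S ⊕ Fin K) (f : Param S K → ℝ) (lam : Param S K) : ℝ :=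
  fderiv ℝ f lam (EuclideanSpace.single s 1)

/-- The vector `D_λ f` of partial derivatives. -/
def grad {S K : ℕ} (f : Param S K → ℝ) (lam : Param S K) : Param S K :=
  WithLp.toLp 2 (fun s => pderiv s f lam)

/-- The matrix `-D²_{λλ} f`. -/
def negHess {S K : ℕ} (f : Param S K → ℝ) (lam : Param S K) :
    Matrix (Fin S ⊕ Fin K) (Fin S ⊕ Fin K) ℝ :=
  Matrix.of fun s t => -pderiv s (pderiv t f) lam

/-- The averaged information matrix `∑_k r_k E(-D²_{λλ} log p*_k(X_k))`, where `X_k` has the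
distribution `Q k`. -/
def avgInfo [MeasurableSpace ΩX] {S K : ℕ} (ψ : Theta S → ΩX → ΩY → ℝ) (y : Fin (K + 1) → ΩY)
    (r : Fin (K + 1) → ℝ) (Q : Fin (K + 1) → Measure ΩX) (lam : Param S K) :
    Matrix (Fin S ⊕ Fin K) (Fin S ⊕ Fin K) ℝ :=
  Matrix.of fun s t => ∑ k, r k * ∫ x, negHess (logProb ψ y k x) lam s t ∂(Q k)

/-- The averaged covariance matrix `∑_k r_k Cov(D_λ log p*_k(X_k))`, where `X_k` has the
distribution `Q k`. -/
def avgCov [MeasurableSpace ΩX] {S K : ℕ} (ψ : Theta S → ΩX → ΩY → ℝ) (y : Fin (K + 1) → ΩY)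
    (r : Fin (K + 1) → ℝ) (Q : Fin (K + 1) → Measure ΩX) (lam : Param S K) :
    Matrix (Fin S ⊕ Fin K) (Fin S ⊕ Fin K) ℝ :=
  Matrix.of fun s t => ∑ k, r k *
    covariance (fun x => pderiv s (logProb ψ y k x) lam)
      (fun x => pderiv t (logProb ψ y k x) lam) (Q k)

end

end OddsRatio

open OddsRatio

/-!
The estimator is asymptotically normal because it solves a linearized score equation. Writing
`n` for the sample size and integrating the Hessian along the segment from `λ₀` to the estimate
`λ̂` gives `A_n (√n (λ̂ - λ₀)) = n^(-1/2) Dℓ(λ₀) - n^(-1/2) Dℓ(λ̂)`, where `A_n` is the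
averaged negative Hessian divided by `n` (`toEuclideanCLM_average_negHess`). By hypothesis `A_n`
tends to `I` and the last term to zero, so `√n (λ̂ - λ₀)` differs from `I⁻¹ n^(-1/2) Dℓ(λ₀)` by a
term that vanishes in probability (`tendstoInMeasure_sub_of_perturbed_equation`). The score at `λ₀`
is a sum over `K + 1` independent i.i.d. samples of sizes proportional to `r`, and it satisfies a
central limit theorem with covariance `Σ` (`tendstoInDistribution_stratified_sum`), once its pooled
mean is known to vanish. This gives the normal limit with covariance `I⁻¹ Σ I⁻¹`.

The special features of the model enter through one observation: at `λ₀`, the functions `p*_k(x)`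
are the conditional probabilities of the strata given `x` in the mixture `∑ k, r k * 𝓛(X | Y = y k)`
(`mul_condDensity_eq`), so pooled expectations can be computed by conditioning on `x`
(`IsPosterior`). Since `∑ k, p*_k = 1` identically in `λ`, differentiating once and twice yields
that the pooled score has mean zero and that `I` is the pooled second moment of the score. Hence
`Σ = I - ∑ k, r k * m_k m_kᵀ`, with `m_k` the mean score in stratum `k`
(`avgCov_eq_avgInfo_sub`). Finally `D²_{λ γ_j} log p*_k = - p*_j D_λ log p*_j` does not depend on
`k`, and its expectation shows that the `γ_j`-column of `I` is `r j * m_j`; thus every `m_k` equals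
`I b_k` with `b_k` supported on the `γ`-coordinates (`exists_avgInfo_mulVec_eq_mean_score`). Therefore
`I⁻¹ Σ I⁻¹ = I⁻¹ - ∑ k, r k * b_k b_kᵀ` has the same `θ`-block as `I⁻¹`.
-/

namespace OddsRatio

/-! ### Central limit theorem for a stratified sample -/

lemma tendsto_charFun_pow_of_centered {Ω : Type*} [MeasurableSpace Ω] {μ : Measure Ω}
    [IsProbabilityMeasure μ] {T : ℕ → Ω → ℝ} (hT : MemLp (T 0) 2 μ) (h0 : μ[T 0] = 0)
    (hindep : iIndepFun T μ) (hident : ∀ i, IdentDistrib (T i) (T 0) μ μ) (u : ℝ) :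
    Tendsto (fun n : ℕ => charFun (μ.map (T 0)) ((√n)⁻¹ * u) ^ n) atTop
      (𝓝 (Complex.exp (-(Var[T 0; μ] * u ^ 2 / 2 : ℝ)))) := by
  have h := tendstoInDistribution_inv_sqrt_mul_sum_sub (P := μ) (X := T) (Y := id)
    (P' := gaussianReal 0 Var[T 0; μ].toNNReal) HasLaw.id hT hindep hident
  have h2 := ProbabilityMeasure.tendsto_iff_tendsto_charFun.1 h.tendsto u
  simp only [h0, mul_zero, sub_zero, ProbabilityMeasure.coe_mk, Measure.map_id,
    charFun_gaussianReal, charFun_inv_sqrt_mul_sum hindep hident] at h2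
  convert h2 using 2
  rw [Real.coe_toNNReal _ (variance_nonneg _ _)]
  push_cast
  congr 1
  ring

/-- Scalar central limit theorem for a stratified sample: stratum `k` contributes the first `N m k`
terms of a centred i.i.d. sequence, and the proportions of the strata are fixed. The characteristic
function factorizes over the strata, and each factor is handled by the classical theorem. -/
lemma tendsto_charFun_stratified {Ω κ : Type*} [MeasurableSpace Ω] [Fintype κ] {μ : Measure Ω}
    [IsProbabilityMeasure μ] {T : κ → ℕ → Ω → ℝ} (hT : ∀ k, MemLp (T k 0) 2 μ)
    (h0 : ∀ k, μ[T k 0] = 0) (hindep : iIndepFun (fun q : κ × ℕ => T q.1 q.2) μ)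
    (hident : ∀ k i, IdentDistrib (T k i) (T k 0) μ μ) {r : κ → ℝ} (hr : ∀ k, 0 < r k)
    {N : ℕ → κ → ℕ} (hN : ∀ m k, (N m k : ℝ) = r k * ((∑ l, N m l : ℕ) : ℝ))
    (hN_top : Tendsto (fun m => ∑ l, N m l) atTop atTop) :
    Tendsto (fun m => charFun (μ.map fun ω =>
        (√((∑ l, N m l : ℕ) : ℝ))⁻¹ * ∑ k, ∑ i ∈ Finset.range (N m k), T k i ω) 1) atTop
      (𝓝 (Complex.exp (-((∑ k, r k * Var[T k 0; μ]) / 2 : ℝ)))) := by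
  classical
  have hmeas : ∀ k i, AEMeasurable (T k i) μ := fun k i => (hident k i).aemeasurable_fst
  have hcf : ∀ m, charFun (μ.map fun ω =>
        (√((∑ l, N m l : ℕ) : ℝ))⁻¹ * ∑ k, ∑ i ∈ Finset.range (N m k), T k i ω) 1
      = ∏ k, charFun (μ.map (T k 0)) ((√(N m k))⁻¹ * √(r k)) ^ N m k := by
    intro m
    set s : Finset (κ × ℕ) := Finset.univ.biUnion
      fun k => (Finset.range (N m k)).image (Prod.mk k) with hs
    have hmem : ∀ q : κ × ℕ, q ∈ s ↔ q.1 ∈ Finset.univ ∧ q.2 ∈ Finset.range (N m q.1) := by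
      rintro ⟨k, i⟩
      simp only [hs, Finset.mem_biUnion, Finset.mem_image, Finset.mem_range, Finset.mem_univ,
        true_and, Prod.mk.injEq]
      exact ⟨by rintro ⟨a, b, hb, rfl, rfl⟩; exact hb, fun h => ⟨k, i, h, rfl, rfl⟩⟩
    have hsum : ∀ ω, ∑ k, ∑ i ∈ Finset.range (N m k), T k i ω = ∑ q ∈ s, T q.1 q.2 ω :=
      fun ω => (Finset.sum_finset_product s Finset.univ
        (fun k => Finset.range (N m k)) hmem (f := fun q => T q.1 q.2 ω)).symm
    simp_rw [hsum]
    rw [charFun_map_mul_comp (Finset.aemeasurable_fun_sum _ fun q _ => hmeas _ _),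
      (hindep.restrict _).charFun_map_fun_finsetSum_eq_prod (fun q _ => hmeas q.1 q.2),
      Finset.prod_apply,
      Finset.prod_finset_product s Finset.univ (fun k => Finset.range (N m k)) hmem]
    refine Finset.prod_congr rfl fun k _ => ?_
    simp only [(hident _ _).map_eq, Finset.prod_const, Finset.card_range]
    -- `√r_k / √N_k = 1 / √n`, except for an empty stratum, where the exponent vanishes.
    rcases Nat.eq_zero_or_pos (N m k) with h | h
    · simp [h]
    · congr 2
      have hk : √(r k) ≠ 0 := (Real.sqrt_pos.2 (hr k)).ne'
      rw [hN m k, Real.sqrt_mul (hr k).le]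
      field_simp
  simp_rw [hcf]
  have hlim : Complex.exp (-((∑ k, r k * Var[T k 0; μ]) / 2 : ℝ))
      = ∏ k, Complex.exp (-(Var[T k 0; μ] * √(r k) ^ 2 / 2 : ℝ)) := by
    rw [← Complex.exp_sum]
    congr 1
    rw [← Complex.ofReal_neg]
    simp_rw [← Complex.ofReal_neg, ← Complex.ofReal_sum]
    congr 1
    simp_rw [Real.sq_sqrt (hr _).le]
    rw [Finset.sum_neg_distrib, Finset.sum_div]
    simp_rw [mul_comm]
  rw [hlim]
  refine tendsto_finsetProd _ fun k _ => ?_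
  have hNk : Tendsto (fun m => N m k) atTop atTop := by
    rw [← tendsto_natCast_atTop_iff (R := ℝ)]
    simp_rw [hN _ k]
    exact (tendsto_natCast_atTop_atTop.comp hN_top).const_mul_atTop (hr k)
  exact (tendsto_charFun_pow_of_centered (hT k) (h0 k)
    (hindep.precomp (g := fun i => (k, i)) fun a b h => (Prod.mk.inj h).2)
    (hident k) √(r k)).comp hNk

/-- The covariance matrix `∑ k, r k * Cov(φ k)` pooled over the strata. -/
noncomputable def pooledCov {κ ι E : Type*} [Fintype κ] [MeasurableSpace E] (r : κ → ℝ)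
    (Q : κ → Measure E) (φ : κ → E → EuclideanSpace ℝ ι) : Matrix ι ι ℝ :=
  Matrix.of fun s t => ∑ k, r k * cov[fun x => φ k x s, fun x => φ k x t; Q k]

section

variable {κ ι E : Type*} [Fintype κ] [Fintype ι] [MeasurableSpace E] {r : κ → ℝ}
  {Q : κ → Measure E} {φ : κ → E → EuclideanSpace ℝ ι}

lemma dotProduct_pooledCov_mulVec [∀ k, IsProbabilityMeasure (Q k)]
    (hφ : ∀ k s, MemLp (fun x => φ k x s) 2 (Q k)) (t : ι → ℝ) :
    t ⬝ᵥ (pooledCov r Q φ).mulVec t = ∑ k, r k * Var[fun x => ∑ s, t s * φ k x s; Q k] := by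
  have hvar : ∀ k, Var[fun x => ∑ s, t s * φ k x s; Q k]
      = ∑ i, ∑ j, t i * t j * cov[fun x => φ k x i, fun x => φ k x j; Q k] := by
    intro k
    rw [variance_fun_sum fun i => (hφ k i).const_mul (t i)]
    refine Finset.sum_congr rfl fun i _ => Finset.sum_congr rfl fun j _ => ?_
    rw [covariance_const_mul_left, covariance_const_mul_right, mul_assoc]
  simp_rw [hvar, dotProduct, Matrix.mulVec, dotProduct, pooledCov, Matrix.of_apply,
    Finset.mul_sum, Finset.sum_mul, Finset.mul_sum]
  rw [Finset.sum_comm_cycle]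
  refine Finset.sum_congr rfl fun k _ => Finset.sum_congr rfl fun i _ =>
    Finset.sum_congr rfl fun j _ => ?_
  ring

lemma posSemidef_pooledCov [∀ k, IsProbabilityMeasure (Q k)] (hr : ∀ k, 0 ≤ r k)
    (hφ : ∀ k s, MemLp (fun x => φ k x s) 2 (Q k)) : (pooledCov r Q φ).PosSemidef := by
  refine Matrix.PosSemidef.of_dotProduct_mulVec_nonneg ?_ fun t => ?_
  · ext s t
    simp [pooledCov, covariance_comm]
  · rw [star_trivial, dotProduct_pooledCov_mulVec hφ]
    exact Finset.sum_nonneg fun k _ => mul_nonneg (hr k) (variance_nonneg _ _)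

/-- Multivariate central limit theorem for a stratified sample with fixed proportions. Only the
pooled mean has to vanish: the sizes of the strata are exactly proportional to `r`, so the means of
the strata cancel in the total sum. -/
lemma tendstoInDistribution_stratified_sum {Ω : Type*} [MeasurableSpace Ω] [DecidableEq ι]
    {μ : Measure Ω} [IsProbabilityMeasure μ] [∀ k, IsProbabilityMeasure (Q k)]
    (hr : ∀ k, 0 < r k) (hφ : ∀ k s, MemLp (fun x => φ k x s) 2 (Q k))
    (hmean : ∀ s, ∑ k, r k * ∫ x, φ k x s ∂(Q k) = 0)
    {X : κ → ℕ → Ω → E} (hX : ∀ k i, HasLaw (X k i) (Q k) μ)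
    (hindep : iIndepFun (fun q : κ × ℕ => X q.1 q.2) μ)
    {N : ℕ → κ → ℕ} (hN : ∀ m k, (N m k : ℝ) = r k * ((∑ l, N m l : ℕ) : ℝ))
    (hN_top : Tendsto (fun m => ∑ l, N m l) atTop atTop) :
    TendstoInDistribution (fun m ω => (√((∑ l, N m l : ℕ) : ℝ))⁻¹ •
        ∑ k, ∑ i ∈ Finset.range (N m k), φ k (X k i ω)) atTop id (fun _ => μ)
      (multivariateGaussian 0 (pooledCov r Q φ)) := by
  have hφm : ∀ k, AEMeasurable (φ k) (Q k) := fun k => by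
    have : AEMeasurable (fun x => (φ k x).ofLp) (Q k) :=
      aemeasurable_pi_lambda _ fun s => (hφ k s).aestronglyMeasurable.aemeasurable
    exact (WithLp.measurable_toLp 2 (ι → ℝ)).comp_aemeasurable this
  have hφX : ∀ k i, AEMeasurable (fun ω => φ k (X k i ω)) μ := fun k i =>
    AEMeasurable.comp_aemeasurable (by rw [(hX k i).map_eq]; exact hφm k) (hX k i).aemeasurable
  have hUm : ∀ m, AEMeasurable (fun ω => (√((∑ l, N m l : ℕ) : ℝ))⁻¹ •
      ∑ k, ∑ i ∈ Finset.range (N m k), φ k (X k i ω)) μ := fun m =>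
    AEMeasurable.fun_const_smul (Finset.aemeasurable_fun_sum _ fun k _ =>
      Finset.aemeasurable_fun_sum _ fun i _ => hφX k i) _
  refine ⟨hUm, by fun_prop, ?_⟩
  refine ProbabilityMeasure.tendsto_iff_tendsto_charFun.2 fun t => ?_
  simp only [ProbabilityMeasure.coe_mk, Measure.map_id]
  rw [charFun_multivariateGaussian (posSemidef_pooledCov (fun k => (hr k).le) hφ)]
  set f : κ → E → ℝ := fun k x => ∑ s, t s * φ k x s with hf
  have hfL : ∀ k, MemLp (f k) 2 (Q k) := fun k =>
    memLp_finsetSum _ fun s _ => (hφ k s).const_mul (t s)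
  set c : κ → ℝ := fun k => ∫ x, f k x ∂(Q k) with hc
  have hcsum : ∑ k, r k * c k = 0 := by
    have : ∀ k, c k = ∑ s, t s * ∫ x, φ k x s ∂(Q k) := fun k => by
      simp only [hc, hf]
      rw [integral_finsetSum _ fun s _ => ((hφ k s).integrable (by norm_num)).const_mul _]
      simp_rw [integral_const_mul]
    simp_rw [this, Finset.mul_sum]
    rw [Finset.sum_comm]
    refine Finset.sum_eq_zero fun s _ => ?_
    rw [← mul_zero (t s), ← hmean s, Finset.mul_sum]
    exact Finset.sum_congr rfl fun k _ => by ring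
  set T : κ → ℕ → Ω → ℝ := fun k i ω => f k (X k i ω) - c k with hTdef
  have hgL : ∀ k, MemLp (fun x => f k x - c k) 2 (Q k) := fun k => (hfL k).sub (memLp_const _)
  have hlaw : ∀ k i, AEMeasurable (fun x => f k x - c k) (μ.map (X k i)) := fun k i => by
    rw [(hX k i).map_eq]; exact (hgL k).aestronglyMeasurable.aemeasurable
  have hident : ∀ k i, IdentDistrib (T k i) (T k 0) μ μ := fun k i =>
    IdentDistrib.comp_of_aemeasurable
      ⟨(hX k i).aemeasurable, (hX k 0).aemeasurable, by rw [(hX k i).map_eq, (hX k 0).map_eq]⟩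
      (hlaw k i)
  have hTL : ∀ k, MemLp (T k 0) 2 μ := fun k => by
    have := hgL k
    rw [← (hX k 0).map_eq] at this
    exact (memLp_map_measure_iff this.aestronglyMeasurable (hX k 0).aemeasurable).1 this
  have hT0 : ∀ k, μ[T k 0] = 0 := fun k => by
    have := (hX k 0).integral_comp (f := fun x => f k x - c k) (hgL k).aestronglyMeasurable
    simp only [Function.comp_def] at this
    rw [this, integral_sub ((hfL k).integrable (by norm_num)) (integrable_const _)]
    simp [hc]
  have hTv : ∀ k, Var[T k 0; μ] = Var[f k; Q k] := fun k => by
    have := variance_map (μ := μ) (Y := X k 0) (X := fun x => f k x - c k)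
      (hlaw k 0) (hX k 0).aemeasurable
    rw [(hX k 0).map_eq, variance_sub_const (hfL k).aestronglyMeasurable] at this
    exact this.symm
  have hTi : iIndepFun (fun q : κ × ℕ => T q.1 q.2) μ :=
    hindep.comp₀ (fun q x => f q.1 x - c q.1) (fun q => (hX _ _).aemeasurable)
      fun q => hlaw _ _
  have key := tendsto_charFun_stratified hTL hT0 hTi hident hr hN hN_top
  have hlim : Complex.exp (↑(inner ℝ t 0) * Complex.I
        - ↑(t.ofLp ⬝ᵥ (pooledCov r Q φ).mulVec t.ofLp) / 2)
      = Complex.exp (-((∑ k, r k * Var[T k 0; μ]) / 2 : ℝ)) := by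
    rw [dotProduct_pooledCov_mulVec hφ]
    simp_rw [hTv]
    simp [hf]
  rw [hlim]
  refine key.congr fun m => ?_
  have hsum : ∀ ω, ∑ k, ∑ i ∈ Finset.range (N m k), T k i ω
      = inner ℝ (∑ k, ∑ i ∈ Finset.range (N m k), φ k (X k i ω)) t := by
    intro ω
    have h1 : ∀ k, ∑ i ∈ Finset.range (N m k), T k i ω
        = ∑ i ∈ Finset.range (N m k), f k (X k i ω) - r k * c k * ((∑ l, N m l : ℕ) : ℝ) := by
      intro k
      simp only [hTdef, Finset.sum_sub_distrib, Finset.sum_const, Finset.card_range, nsmul_eq_mul,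
        hN m k]
      ring
    simp_rw [h1]
    rw [Finset.sum_sub_distrib, ← Finset.sum_mul, hcsum, zero_mul, sub_zero]
    simp_rw [sum_inner]
    refine Finset.sum_congr rfl fun k _ => Finset.sum_congr rfl fun i _ => ?_
    simp [hf, PiLp.inner_apply]
  simp_rw [hsum]
  rw [charFun_apply, charFun_apply, integral_map, integral_map]
  · simp [real_inner_smul_left]
  · exact hUm m
  · exact (by fun_prop : Continuous _).aestronglyMeasurable
  · exact AEMeasurable.const_mul (AEMeasurable.inner_const (Finset.aemeasurable_fun_sum _
      fun k _ => Finset.aemeasurable_fun_sum _ fun i _ => hφX k i)) _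
  · exact (by fun_prop : Continuous _).aestronglyMeasurable

end

/-! ### Solving a perturbed linear equation in the limit -/

lemma exists_measure_norm_gt_lt {Ω Ω' ι : Type*} [Fintype ι] [MeasurableSpace Ω]
    [MeasurableSpace Ω'] {μ : Measure Ω} [IsProbabilityMeasure μ] {μ' : Measure Ω'}
    [IsProbabilityMeasure μ'] {U : ℕ → Ω → EuclideanSpace ℝ ι} {Z : Ω' → EuclideanSpace ℝ ι}
    (h : TendstoInDistribution U atTop Z (fun _ => μ) μ') {ε : ℝ≥0∞} (hε : 0 < ε) :
    ∃ C : ℝ, 0 < C ∧ ∀ m, μ {ω | C < ‖U m ω‖} ≤ ε := by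
  have hprob : ∀ m, IsProbabilityMeasure (μ.map (U m)) :=
    fun m => Measure.isProbabilityMeasure_map (h.forall_aemeasurable m)
  have hZp : IsProbabilityMeasure (μ'.map Z) := Measure.isProbabilityMeasure_map h.aemeasurable_limit
  have ht : IsTightMeasureSet (Set.range fun m => μ.map (U m)) :=
    isTightMeasureSet_of_tendsto_charFun (f := charFun (μ'.map Z)) (by fun_prop)
      (ProbabilityMeasure.tendsto_iff_tendsto_charFun.1 h.tendsto)
  have h1 := tendsto_measure_norm_gt_of_isTightMeasureSet ht
  obtain ⟨C, hC, hC0⟩ := ((h1.eventually_lt_const hε).and (eventually_gt_atTop 0)).exists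
  refine ⟨C, hC0, fun m => ?_⟩
  have h2 : (μ.map (U m)) {x | C < ‖x‖} ≤ ε :=
    (le_iSup₂_of_le (μ.map (U m)) ⟨m, rfl⟩ le_rfl).trans hC.le
  rwa [Measure.map_apply_of_aemeasurable (h.forall_aemeasurable m)
    (measurableSet_lt measurable_const measurable_norm)] at h2

/-- If `A_m W_m = U_m + R_m` with `A_m → A` and `R_m → 0` in probability, `A` invertible with
inverse `B`, and `U_m` convergent in distribution, then `W_m - B U_m → 0` in probability. The
random operators `A_m` and the remainders `R_m` need not be measurable: the usual version of
Slutsky's theorem is replaced by an explicit bound outside an event of small outer measure. -/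
lemma tendstoInMeasure_sub_of_perturbed_equation {Ω Ω' ι : Type*} [Fintype ι] [MeasurableSpace Ω]
    [MeasurableSpace Ω'] {μ : Measure Ω} [IsProbabilityMeasure μ] {μ' : Measure Ω'}
    [IsProbabilityMeasure μ'] {U W R : ℕ → Ω → EuclideanSpace ℝ ι} {Z : Ω' → EuclideanSpace ℝ ι}
    {A B : EuclideanSpace ℝ ι →L[ℝ] EuclideanSpace ℝ ι}
    {A' : ℕ → Ω → EuclideanSpace ℝ ι →L[ℝ] EuclideanSpace ℝ ι}
    (hBA : ∀ v, B (A v) = v) (hU : TendstoInDistribution U atTop Z (fun _ => μ) μ')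
    (hR : TendstoInMeasure μ R atTop (fun _ => 0))
    (hA : TendstoInMeasure μ A' atTop (fun _ => A))
    (heq : ∀ m ω, A' m ω (W m ω) = U m ω + R m ω) :
    TendstoInMeasure μ (fun m ω => W m ω - B (U m ω)) atTop (fun _ => 0) := by
  rw [tendstoInMeasure_iff_norm]
  intro ε hε
  rw [ENNReal.tendsto_nhds_zero]
  intro δ hδ
  obtain ⟨C, hC0, hC⟩ := exists_measure_norm_gt_lt hU (ENNReal.div_pos hδ.ne' (by simp) :
    0 < δ / 3)
  set b : ℝ := ‖B‖ + 1 with hb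
  have hb0 : 0 < b := by positivity
  -- `η` makes `B (A - A_m)` a contraction with factor `1/2` and the final error at most `ε / 2`.
  set η : ℝ := min (min 1 (1 / (2 * b))) (ε / (2 * b * (2 * b * (C + 1) + 1))) with hη
  have hη0 : 0 < η := by positivity
  rw [tendstoInMeasure_iff_norm] at hR hA
  have hR' := (hR η hη0).eventually_le_const (ENNReal.div_pos hδ.ne' (by simp) : 0 < δ / 3)
  have hA' := (hA η hη0).eventually_le_const (ENNReal.div_pos hδ.ne' (by simp) : 0 < δ / 3)
  filter_upwards [hR', hA'] with m hRm hAm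
  have hsub : {ω | ε ≤ ‖W m ω - B (U m ω) - 0‖} ⊆
      {ω | C < ‖U m ω‖} ∪ {ω | η ≤ ‖R m ω - 0‖} ∪ {ω | η ≤ ‖A' m ω - A‖} := by
    intro ω hω
    by_contra hcon
    simp only [Set.mem_union, Set.mem_ofPred_eq, not_or, not_lt, not_le, sub_zero] at hcon hω
    obtain ⟨⟨h1, h2⟩, h3⟩ := hcon
    have hW : W m ω - B (U m ω) = B (R m ω) - B ((A' m ω - A) (W m ω)) := by
      rw [sub_apply, map_sub, hBA, heq m ω, map_add]
      abel
    have hBn : ∀ v, ‖B v‖ ≤ b * ‖v‖ := fun v =>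
      (B.le_opNorm v).trans (by gcongr; simp [hb])
    have hd : ‖(A' m ω - A) (W m ω)‖ ≤ η * ‖W m ω‖ :=
      ((A' m ω - A).le_opNorm _).trans (by gcongr)
    have herr : ‖W m ω - B (U m ω)‖ ≤ b * η + b * (η * ‖W m ω‖) := by
      rw [hW]
      refine (norm_sub_le _ _).trans (add_le_add ?_ ?_)
      · exact (hBn _).trans (by gcongr)
      · exact (hBn _).trans (by gcongr)
    have hη1 : η ≤ 1 := (min_le_left _ _).trans (min_le_left _ _)
    have hη2 : η * (2 * b) ≤ 1 := by
      rw [← le_div_iff₀ (by positivity)]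
      exact (min_le_left _ _).trans (min_le_right _ _)
    have hη3 : η * (2 * b * (2 * b * (C + 1) + 1)) ≤ ε := by
      rw [← le_div_iff₀ (by positivity)]
      exact min_le_right _ _
    have hWn : ‖W m ω‖ ≤ 2 * b * (C + 1) := by
      have h4 : ‖W m ω‖ ≤ ‖W m ω - B (U m ω)‖ + ‖B (U m ω)‖ := by
        simpa using norm_add_le (W m ω - B (U m ω)) (B (U m ω))
      have h5 : ‖B (U m ω)‖ ≤ b * C := (hBn _).trans (by gcongr)
      have h6 : η * (2 * b) * ‖W m ω‖ ≤ 1 * ‖W m ω‖ := by gcongr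
      have h7 : b * η ≤ b * 1 := by gcongr
      nlinarith
    have h8 : b * (η * ‖W m ω‖) ≤ b * (η * (2 * b * (C + 1))) := by gcongr
    nlinarith
  calc μ {ω | ε ≤ ‖W m ω - B (U m ω) - 0‖}
      ≤ μ {ω | C < ‖U m ω‖} + μ {ω | η ≤ ‖R m ω - 0‖} + μ {ω | η ≤ ‖A' m ω - A‖} :=
        (measure_mono hsub).trans ((measure_union_le _ _).trans
          (add_le_add (measure_union_le _ _) le_rfl))
    _ ≤ δ / 3 + δ / 3 + δ / 3 := by gcongr; exact hC m
    _ = δ := ENNReal.add_thirds δ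

/-- Entrywise convergence in probability of random matrices implies convergence in probability of
the associated operators on Euclidean space. -/
lemma tendstoInMeasure_toEuclideanCLM {Ω ι : Type*} [Fintype ι] [DecidableEq ι]
    [MeasurableSpace Ω] {μ : Measure Ω} {M : ℕ → Ω → Matrix ι ι ℝ} {M₀ : Matrix ι ι ℝ}
    (h : ∀ s t, TendstoInMeasure μ (fun m ω => M m ω s t) atTop (fun _ => M₀ s t)) :
    TendstoInMeasure μ (fun m ω => Matrix.toEuclideanCLM (𝕜 := ℝ) (M m ω)) atTop
      (fun _ => Matrix.toEuclideanCLM (𝕜 := ℝ) M₀) := by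
  set e : Matrix ι ι ℝ →ₗ[ℝ] EuclideanSpace ℝ ι →L[ℝ] EuclideanSpace ℝ ι :=
    (Matrix.toEuclideanCLM (n := ι) (𝕜 := ℝ)).toAlgEquiv.toLinearMap with he
  have hbound : ∀ P : Matrix ι ι ℝ, ‖e P‖ ≤ ∑ s, ∑ t, |P s t| * ‖e (Matrix.single s t 1)‖ := by
    intro P
    conv_lhs => rw [Matrix.matrix_eq_sum_single P]
    rw [map_sum]
    refine (norm_sum_le _ _).trans (Finset.sum_le_sum fun s _ => ?_)
    rw [map_sum]
    refine (norm_sum_le _ _).trans (Finset.sum_le_sum fun t _ => ?_)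
    have : Matrix.single s t (P s t) = P s t • Matrix.single s t (1 : ℝ) := by simp
    rw [this, map_smul, norm_smul, Real.norm_eq_abs]
  set D : ℝ := ∑ s, ∑ t, ‖e (Matrix.single s t 1)‖ with hD
  have hD0 : 0 ≤ D := by positivity
  simp_rw [tendstoInMeasure_iff_norm] at h ⊢
  intro ε hε
  have hη : 0 < ε / (D + 1) := by positivity
  have hsum : Tendsto (fun m => ∑ s, ∑ t, μ {ω | ε / (D + 1) ≤ ‖M m ω s t - M₀ s t‖}) atTop
      (𝓝 0) := by
    have := tendsto_finsetSum (Finset.univ : Finset ι) fun s _ =>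
      tendsto_finsetSum (Finset.univ : Finset ι) fun t _ => h s t _ hη
    simpa using this
  refine tendsto_of_tendsto_of_tendsto_of_le_of_le tendsto_const_nhds hsum (fun _ => zero_le)
    fun m => ?_
  have hsub : {ω | ε ≤ ‖Matrix.toEuclideanCLM (𝕜 := ℝ) (M m ω)
      - Matrix.toEuclideanCLM (𝕜 := ℝ) M₀‖} ⊆
      ⋃ s, ⋃ t, {ω | ε / (D + 1) ≤ ‖M m ω s t - M₀ s t‖} := by
    intro ω hω
    by_contra hcon
    simp only [Set.mem_iUnion, Set.mem_ofPred_eq, not_exists, not_le] at hcon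
    have h1 : ‖e (M m ω - M₀)‖ ≤ ε / (D + 1) * D := by
      refine (hbound _).trans ?_
      rw [hD, Finset.mul_sum]
      refine Finset.sum_le_sum fun s _ => ?_
      rw [Finset.mul_sum]
      exact Finset.sum_le_sum fun t _ => by gcongr; exact (hcon s t).le
    have h2 : ε / (D + 1) * D < ε := by
      rw [div_mul_eq_mul_div, div_lt_iff₀ (by positivity)]
      nlinarith
    rw [map_sub] at h1
    exact absurd (le_trans hω h1) (not_le.2 h2)
  refine (measure_mono hsub).trans ((measure_iUnion_fintype_le _ _).trans
    (Finset.sum_le_sum fun s _ => measure_iUnion_fintype_le _ _))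

/-! ### Linear images of Gaussian limits -/

lemma multivariateGaussian_map_mulVec {ι κ : Type*} [Fintype ι] [DecidableEq ι] [Fintype κ]
    [DecidableEq κ] {C : Matrix ι ι ℝ} (hC : C.PosSemidef) (A : Matrix κ ι ℝ) :
    (multivariateGaussian 0 C).map (fun x => WithLp.toLp 2 (A.mulVec x.ofLp))
      = multivariateGaussian 0 (A * C * A.transpose) := by
  have hC' : (A * C * A.transpose).PosSemidef := by
    simpa using hC.mul_mul_conjTranspose_same A
  have hmeas : Measurable fun x : EuclideanSpace ℝ ι =>
      (WithLp.toLp 2 (A.mulVec x.ofLp) : EuclideanSpace ℝ κ) := by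
    have : Continuous fun x : EuclideanSpace ℝ ι =>
      (WithLp.toLp 2 (A.mulVec x.ofLp) : EuclideanSpace ℝ κ) := by fun_prop
    exact this.measurable
  have hp := Measure.isProbabilityMeasure_map (μ := multivariateGaussian 0 C) hmeas.aemeasurable
  refine Measure.ext_of_charFun (funext fun t => ?_)
  have h1 : charFun ((multivariateGaussian 0 C).map
        (fun x => (WithLp.toLp 2 (A.mulVec x.ofLp) : EuclideanSpace ℝ κ))) t
      = charFun (multivariateGaussian 0 C) (WithLp.toLp 2 (A.transpose.mulVec t.ofLp)) := by
    rw [charFun_apply, charFun_apply, integral_map hmeas.aemeasurable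
      (by fun_prop : Continuous _).aestronglyMeasurable]
    refine integral_congr_ae (ae_of_all _ fun x => ?_)
    have : inner ℝ (WithLp.toLp 2 (A.mulVec x.ofLp)) t
        = inner ℝ x (WithLp.toLp 2 (A.transpose.mulVec t.ofLp)) := by
      simp only [EuclideanSpace.inner_eq_star_dotProduct, star_trivial]
      rw [Matrix.dotProduct_mulVec, Matrix.mulVec_transpose]
    simp only [this]
  rw [h1, charFun_multivariateGaussian hC, charFun_multivariateGaussian hC']
  congr 2
  · simp
  · rw [← Matrix.mulVec_mulVec, ← Matrix.mulVec_mulVec, Matrix.dotProduct_mulVec t.ofLp,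
      ← Matrix.mulVec_transpose]

lemma TendstoInDistribution.mulVec_multivariateGaussian {Ω ι κ : Type*} [MeasurableSpace Ω]
    [Fintype ι] [DecidableEq ι] [Fintype κ] [DecidableEq κ] {μ : Measure Ω}
    [IsProbabilityMeasure μ] {U : ℕ → Ω → EuclideanSpace ℝ ι} {C : Matrix ι ι ℝ}
    (hC : C.PosSemidef)
    (h : TendstoInDistribution U atTop id (fun _ => μ) (multivariateGaussian 0 C))
    (A : Matrix κ ι ℝ) :
    TendstoInDistribution (fun m ω => WithLp.toLp 2 (A.mulVec (U m ω).ofLp)) atTop id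
      (fun _ => μ) (multivariateGaussian 0 (A * C * A.transpose)) := by
  have hcont : Continuous fun x : EuclideanSpace ℝ ι =>
      (WithLp.toLp 2 (A.mulVec x.ofLp) : EuclideanSpace ℝ κ) := by fun_prop
  have h2 := h.continuous_comp hcont
  refine ⟨h2.forall_aemeasurable, by fun_prop, h2.tendsto.trans (le_of_eq ?_)⟩
  congr 1
  refine Subtype.ext ?_
  change Measure.map _ _ = Measure.map _ _
  rw [Measure.map_id, Function.comp_id, multivariateGaussian_map_mulVec hC]

/-! ### Derivatives of the log-probabilities -/

section

variable {S K : ℕ}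

lemma contDiff_gammaExt (k : Fin (K + 1)) {n : WithTop ℕ∞} :
    ContDiff ℝ n fun lam : Param S K => gammaExt lam k := by
  refine Fin.cases ?_ (fun j => ?_) k
  · simpa [gammaExt] using contDiff_const
  · simp only [gammaExt, Fin.cons_succ]
    fun_prop

lemma contDiff_thetaPart {n : WithTop ℕ∞} : ContDiff ℝ n (thetaPart : Param S K → Theta S) := by
  unfold thetaPart
  fun_prop

lemma gammaExt_add_smul_single (lam : Param S K) (j : Fin K) (u : ℝ) (k : Fin (K + 1)) :
    gammaExt (lam + u • EuclideanSpace.single (Sum.inr j) 1) k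
      = gammaExt lam k + if k = j.succ then u else 0 := by
  refine Fin.cases ?_ (fun i => ?_) k
  · simp [gammaExt, (Fin.succ_ne_zero j).symm]
  · simp [gammaExt]

lemma thetaPart_add_smul_single (lam : Param S K) (j : Fin K) (u : ℝ) :
    thetaPart (lam + u • EuclideanSpace.single (Sum.inr j) 1) = thetaPart lam := by
  ext s
  simp [thetaPart]

lemma hasDerivAt_pderiv {f : Param S K → ℝ} {lam : Param S K} (hf : DifferentiableAt ℝ f lam)
    (s : Fin S ⊕ Fin K) :
    HasDerivAt (fun u : ℝ => f (lam + u • EuclideanSpace.single s 1)) (pderiv s f lam) 0 :=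
  hf.hasFDerivAt.hasLineDerivAt _

lemma pderiv_eq_of_hasDerivAt {f : Param S K → ℝ} {lam : Param S K} {c : ℝ}
    (hf : DifferentiableAt ℝ f lam) {s : Fin S ⊕ Fin K}
    (h : HasDerivAt (fun u : ℝ => f (lam + u • EuclideanSpace.single s 1)) c 0) :
    pderiv s f lam = c :=
  (hasDerivAt_pderiv hf s).unique h

lemma contDiff_pderiv {f : Param S K → ℝ} {n m : WithTop ℕ∞} (hf : ContDiff ℝ n f)
    (hmn : m + 1 ≤ n) (s : Fin S ⊕ Fin K) : ContDiff ℝ m (pderiv s f) :=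
  (hf.fderiv_right hmn).clm_apply contDiff_const

lemma pderiv_sum {ι : Type*} (A : Finset ι) {f : ι → Param S K → ℝ} {lam : Param S K}
    (hf : ∀ i ∈ A, DifferentiableAt ℝ (f i) lam) (s : Fin S ⊕ Fin K) :
    pderiv s (fun l => ∑ i ∈ A, f i l) lam = ∑ i ∈ A, pderiv s (f i) lam := by
  simp [pderiv, fderiv_fun_sum hf]

lemma fderiv_apply_eq_sum_pderiv (f : Param S K → ℝ) (lam v : Param S K) :
    fderiv ℝ f lam v = ∑ s, v s * pderiv s f lam := by
  conv_lhs => rw [← (EuclideanSpace.basisFun (Fin S ⊕ Fin K) ℝ).sum_repr v]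
  rw [map_sum]
  exact Finset.sum_congr rfl fun s _ => by simp [pderiv]

/-- Integral form of the mean value theorem for the gradient, with the averaged Hessian. -/
lemma grad_sub_grad {f : Param S K → ℝ} (hf : ContDiff ℝ 2 f) (a b : Param S K) :
    (Matrix.of fun s t => ∫ u in (0 : ℝ)..1, negHess f (a + u • (b - a)) s t).transpose.mulVec
      (b - a).ofLp = (grad f a - grad f b).ofLp := by
  ext t
  have hg : ContDiff ℝ 1 (pderiv t f) := contDiff_pderiv hf (by norm_num) t
  have hline : ∀ u : ℝ, HasDerivAt (fun u : ℝ => a + u • (b - a)) (b - a) u := fun u => by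
    simpa using ((hasDerivAt_id u).smul_const (b - a)).const_add a
  have hcont : ∀ s, Continuous fun u : ℝ => pderiv s (pderiv t f) (a + u • (b - a)) := fun s =>
    (contDiff_pderiv hg (m := 0) (by norm_num) s).continuous.comp (by fun_prop)
  have hder : ∀ u : ℝ, HasDerivAt (fun u : ℝ => pderiv t f (a + u • (b - a)))
      (∑ s, (b - a) s * pderiv s (pderiv t f) (a + u • (b - a))) u := by
    intro u
    refine (((hg.differentiable (by norm_num) (a + u • (b - a))).hasFDerivAt).comp_hasDerivAt u
      (hline u)).congr_deriv ?_
    exact fderiv_apply_eq_sum_pderiv _ _ _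
  have hint := intervalIntegral.integral_eq_sub_of_hasDerivAt (a := 0) (b := 1)
    (fun u _ => hder u)
    ((continuous_finsetSum _ fun s _ => (hcont s).const_mul _).intervalIntegrable 0 1)
  rw [intervalIntegral.integral_finsetSum
    fun s _ => ((hcont s).const_mul _).intervalIntegrable 0 1] at hint
  simp only [intervalIntegral.integral_const_mul, one_smul, zero_smul, add_zero,
    add_sub_cancel] at hint
  simp only [Matrix.mulVec, dotProduct, Matrix.transpose_apply, Matrix.of_apply, negHess,
    intervalIntegral.integral_neg, grad, PiLp.sub_apply]
  rw [← neg_sub (pderiv t f b), ← hint, ← Finset.sum_neg_distrib]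
  refine Finset.sum_congr rfl fun s _ => ?_
  rw [PiLp.sub_apply]
  ring

variable {ΩX ΩY : Type*} {ψ : Theta S → ΩX → ΩY → ℝ} {y : Fin (K + 1) → ΩY} {x : ΩX}

lemma exp_logProb (k : Fin (K + 1)) (lam : Param S K) :
    Real.exp (logProb ψ y k x lam) = Real.exp (gammaExt lam k + ψ (thetaPart lam) x (y k))
      / ∑ l, Real.exp (gammaExt lam l + ψ (thetaPart lam) x (y l)) := by
  rw [logProb, Real.exp_sub, Real.exp_log]
  exact Finset.sum_pos (fun l _ => Real.exp_pos _) Finset.univ_nonempty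

lemma sum_exp_logProb (lam : Param S K) : ∑ k, Real.exp (logProb ψ y k x lam) = 1 := by
  simp_rw [exp_logProb, ← Finset.sum_div]
  exact div_self (Finset.sum_pos (fun l _ => Real.exp_pos _) Finset.univ_nonempty).ne'

lemma contDiff_logProb (hψ : ∀ k, ContDiff ℝ 3 fun θ => ψ θ x (y k))
    (k : Fin (K + 1)) : ContDiff ℝ 3 (logProb ψ y k x) := by
  have h : ∀ l, ContDiff ℝ 3 fun lam : Param S K => gammaExt lam l + ψ (thetaPart lam) x (y l) :=
    fun l => (contDiff_gammaExt l).add ((hψ l).comp contDiff_thetaPart)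
  exact (h k).sub ((ContDiff.sum fun l _ => (h l).exp).log fun lam =>
    (Finset.sum_pos (fun l _ => Real.exp_pos _) Finset.univ_nonempty).ne')

/-- The conditional expectation of the score given `X = x` vanishes. -/
lemma sum_exp_mul_pderiv_logProb (hψ : ∀ k, ContDiff ℝ 3 fun θ => ψ θ x (y k))
    (s : Fin S ⊕ Fin K) (lam : Param S K) :
    ∑ k, Real.exp (logProb ψ y k x lam) * pderiv s (logProb ψ y k x) lam = 0 := by
  have hd : ∀ k, DifferentiableAt ℝ (logProb ψ y k x) lam :=
    fun k => (contDiff_logProb hψ k).differentiable (by norm_num) lam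
  have h1 : HasDerivAt (fun u : ℝ => ∑ k, Real.exp
      (logProb ψ y k x (lam + u • EuclideanSpace.single s 1)))
      (∑ k, Real.exp (logProb ψ y k x lam) * pderiv s (logProb ψ y k x) lam) 0 := by
    refine HasDerivAt.fun_sum fun k _ => ?_
    simpa using (hasDerivAt_pderiv (hd k) s).exp
  simp_rw [sum_exp_logProb] at h1
  exact h1.unique (hasDerivAt_const _ _)

/-- The conditional form of the second Bartlett identity: given `X = x`, the expected negative
Hessian of the log-probability is the expected outer product of the score. -/
lemma sum_exp_mul_negHess_logProb (hψ : ∀ k, ContDiff ℝ 3 fun θ => ψ θ x (y k))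
    (s t : Fin S ⊕ Fin K) (lam : Param S K) :
    ∑ k, Real.exp (logProb ψ y k x lam) * negHess (logProb ψ y k x) lam s t
      = ∑ k, Real.exp (logProb ψ y k x lam) *
        (pderiv s (logProb ψ y k x) lam * pderiv t (logProb ψ y k x) lam) := by
  have hd : ∀ k, DifferentiableAt ℝ (logProb ψ y k x) lam :=
    fun k => (contDiff_logProb hψ k).differentiable (by norm_num) lam
  have hd2 : ∀ k, DifferentiableAt ℝ (pderiv t (logProb ψ y k x)) lam := fun k =>
    (contDiff_pderiv (contDiff_logProb hψ k) (m := 1) (by norm_num) t).differentiable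
      (by norm_num) lam
  have h1 : HasDerivAt (fun u : ℝ => ∑ k,
      Real.exp (logProb ψ y k x (lam + u • EuclideanSpace.single s 1)) *
        pderiv t (logProb ψ y k x) (lam + u • EuclideanSpace.single s 1))
      (∑ k, (Real.exp (logProb ψ y k x lam) * pderiv s (logProb ψ y k x) lam
        * pderiv t (logProb ψ y k x) lam + Real.exp (logProb ψ y k x lam)
        * pderiv s (pderiv t (logProb ψ y k x)) lam)) 0 := by
    refine HasDerivAt.fun_sum fun k _ => ?_
    simpa using (hasDerivAt_pderiv (hd k) s).exp.fun_mul (hasDerivAt_pderiv (hd2 k) s)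
  simp_rw [sum_exp_mul_pderiv_logProb hψ] at h1
  have h2 := h1.unique (hasDerivAt_const _ _)
  rw [← sub_eq_zero, ← Finset.sum_sub_distrib, ← neg_eq_zero, ← h2, ← Finset.sum_neg_distrib]
  refine Finset.sum_congr rfl fun k _ => ?_
  simp only [negHess, Matrix.of_apply]
  ring

lemma pderiv_inr_logProb (hψ : ∀ k, ContDiff ℝ 3 fun θ => ψ θ x (y k))
    (j : Fin K) (k : Fin (K + 1)) (lam : Param S K) :
    pderiv (Sum.inr j) (logProb ψ y k x) lam
      = (if k = j.succ then 1 else 0) - Real.exp (logProb ψ y j.succ x lam) := by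
  refine pderiv_eq_of_hasDerivAt ((contDiff_logProb hψ k).differentiable (by norm_num) lam) ?_
  simp only [logProb, gammaExt_add_smul_single, thetaPart_add_smul_single]
  have h0 : ∀ l : Fin (K + 1), HasDerivAt (fun u : ℝ => gammaExt lam l + (if l = j.succ then u else 0)
      + ψ (thetaPart lam) x (y l)) (if l = j.succ then 1 else 0) 0 := by
    intro l
    split_ifs
    · exact ((hasDerivAt_id (0 : ℝ)).const_add _).add_const _
    · exact hasDerivAt_const _ _
  have hs : HasDerivAt (fun u : ℝ => ∑ l, Real.exp (gammaExt lam l + (if l = j.succ then u else 0)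
      + ψ (thetaPart lam) x (y l)))
      (Real.exp (gammaExt lam j.succ + ψ (thetaPart lam) x (y j.succ))) 0 := by
    have := HasDerivAt.fun_sum (u := Finset.univ) fun l _ => (h0 l).exp
    simpa using this
  have hpos : 0 < ∑ l, Real.exp (gammaExt lam l + ψ (thetaPart lam) x (y l)) :=
    Finset.sum_pos (fun l _ => Real.exp_pos _) Finset.univ_nonempty
  refine ((h0 k).fun_sub (hs.log (by simpa using hpos.ne'))).congr_deriv ?_
  rw [Real.exp_sub, Real.exp_log hpos]
  simp

/-- The column of the negative Hessian that belongs to `γ_j` is the score at the sample value `y_j`,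
weighted with its probability, whichever `k` is observed. -/
lemma negHess_inr_logProb (hψ : ∀ k, ContDiff ℝ 3 fun θ => ψ θ x (y k))
    (s : Fin S ⊕ Fin K) (j : Fin K) (k : Fin (K + 1)) (lam : Param S K) :
    negHess (logProb ψ y k x) lam s (Sum.inr j)
      = Real.exp (logProb ψ y j.succ x lam) * pderiv s (logProb ψ y j.succ x) lam := by
  have hd : DifferentiableAt ℝ (logProb ψ y j.succ x) lam :=
    (contDiff_logProb hψ _).differentiable (by norm_num) lam
  have h1 : pderiv (Sum.inr j) (logProb ψ y k x)
      = fun lam => (if k = j.succ then 1 else 0) - Real.exp (logProb ψ y j.succ x lam) :=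
    funext (pderiv_inr_logProb hψ j k)
  simp only [negHess, Matrix.of_apply]
  rw [h1]
  have h2 := ((hasDerivAt_pderiv hd s).exp).const_sub (if k = j.succ then (1 : ℝ) else 0)
  rw [pderiv_eq_of_hasDerivAt (hd.exp.const_sub _) h2]
  simp

lemma contDiff_logLik (hψ : ∀ x k, ContDiff ℝ 3 fun θ => ψ θ x (y k)) (n : Fin (K + 1) → ℕ)
    (X : Fin (K + 1) → ℕ → ΩX) : ContDiff ℝ 3 (logLik ψ y n X) :=
  ContDiff.sum fun k _ => ContDiff.sum fun i _ => contDiff_logProb (hψ (X k i)) k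

lemma grad_logLik (hψ : ∀ x k, ContDiff ℝ 3 fun θ => ψ θ x (y k)) (n : Fin (K + 1) → ℕ)
    (X : Fin (K + 1) → ℕ → ΩX) (lam : Param S K) :
    grad (logLik ψ y n X) lam
      = ∑ k, ∑ i ∈ Finset.range (n k), grad (logProb ψ y k (X k i)) lam := by
  have hd : ∀ k i, DifferentiableAt ℝ (logProb ψ y k (X k i)) lam :=
    fun k i => (contDiff_logProb (hψ (X k i)) k).differentiable (by norm_num) lam
  ext s
  simp only [grad, WithLp.ofLp_sum, Finset.sum_apply]
  unfold logLik
  rw [pderiv_sum _ fun k _ => DifferentiableAt.fun_sum fun i _ => hd k i]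
  exact Finset.sum_congr rfl fun k _ => pderiv_sum _ (fun i _ => hd k i) s

end

/-! ### The sampling model as a joint model -/

/-- The functions `e k` act as conditional probabilities of the strata `k` given the observation
`x`, when stratum `k` has weight `r k` and distribution `Q k`: a pooled expectation
`∑ k, r k * ∫ g k ∂(Q k)` depends on `g` only through the conditional mean
`∑ k, e k x * g k x`. -/
def IsPosterior {κ E : Type*} [Fintype κ] [MeasurableSpace E] (r : κ → ℝ) (Q : κ → Measure E)
    (e : κ → E → ℝ) : Prop :=
  ∀ g h : κ → E → ℝ, (∀ k, Integrable (g k) (Q k)) → (∀ k, Integrable (h k) (Q k)) →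
    (∀ x, ∑ k, e k x * g k x = ∑ k, e k x * h k x) →
    ∑ k, r k * ∫ x, g k x ∂(Q k) = ∑ k, r k * ∫ x, h k x ∂(Q k)

lemma isPosterior_withDensity {κ E : Type*} [Fintype κ] [MeasurableSpace E] {ν : Measure E}
    {r : κ → ℝ} {q : κ → E → ℝ} {e : κ → E → ℝ} {c : E → ℝ} (hq : ∀ k, Measurable (q k))
    (hq0 : ∀ k x, 0 ≤ q k x) (he : ∀ k x, r k * q k x = c x * e k x) :
    IsPosterior r (fun k => ν.withDensity fun x => ENNReal.ofReal (q k x)) e := by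
  intro g h hg hh heq
  have hint : ∀ (k : κ) (f : E → ℝ), ∫ x, f x ∂(ν.withDensity fun x => ENNReal.ofReal (q k x))
      = ∫ x, q k x * f x ∂ν := fun k f => by
    rw [integral_withDensity_eq_integral_toReal_smul (hq k).ennreal_ofReal
      (ae_of_all _ fun x => ENNReal.ofReal_lt_top)]
    simp [ENNReal.toReal_ofReal (hq0 k _)]
  have hintb : ∀ (k : κ) (f : E → ℝ),
      Integrable f (ν.withDensity fun x => ENNReal.ofReal (q k x)) →
      Integrable (fun x => r k * (q k x * f x)) ν := fun k f hf => by
    rw [integrable_withDensity_iff_integrable_smul' (hq k).ennreal_ofReal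
      (ae_of_all _ fun x => ENNReal.ofReal_lt_top)] at hf
    refine Integrable.const_mul ?_ _
    simpa [ENNReal.toReal_ofReal (hq0 k _)] using hf
  simp_rw [hint, ← integral_const_mul]
  rw [← integral_finsetSum _ fun k _ => hintb k _ (hg k),
    ← integral_finsetSum _ fun k _ => hintb k _ (hh k)]
  refine integral_congr_ae (ae_of_all _ fun x => ?_)
  simp only [← mul_assoc, he]
  simp only [mul_assoc, ← Finset.mul_sum, heq]

section

variable {ΩX ΩY : Type*} [MeasurableSpace ΩX] {S K : ℕ}

lemma thetaPart_trueParam (νX : Measure ΩX) (p : ΩX → ΩY → ℝ) (x₀ : ΩX) (y : Fin (K + 1) → ΩY)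
    (r : Fin (K + 1) → ℝ) (θ₀ : Theta S) : thetaPart (trueParam νX p x₀ y r θ₀) = θ₀ := rfl

/-- At the true parameter, `exp (log p*_k)` is the conditional probability of stratum `k`: the
normalizing integrals and the values of `p` at the reference points cancel. -/
lemma mul_condDensity_eq {νX : Measure ΩX} {p : ΩX → ΩY → ℝ} {x₀ : ΩX} {y : Fin (K + 1) → ΩY}
    {r : Fin (K + 1) → ℝ} {θ₀ : Theta S} {ψ : Theta S → ΩX → ΩY → ℝ}
    (hp_pos : ∀ x y', 0 < p x y') (hZ : ∀ k, 0 < ∫ x, p x (y k) ∂νX) (hr : ∀ k, 0 < r k)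
    (hOR : ∀ x y', logOddsRatio p x₀ (y 0) x y' = ψ θ₀ x y') (k : Fin (K + 1)) (x : ΩX) :
    r k * condDensity νX p (y k) x = (∑ l, r l * condDensity νX p (y l) x) *
      Real.exp (logProb ψ y k x (trueParam νX p x₀ y r θ₀)) := by
  have hq : ∀ l x, 0 < condDensity νX p (y l) x := fun l x => div_pos (hp_pos _ _) (hZ l)
  have hη : ∀ l, Real.exp (gammaExt (trueParam νX p x₀ y r θ₀) l + ψ θ₀ x (y l))
      = r l * condDensity νX p (y l) x / (r 0 * condDensity νX p (y 0) x) := by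
    intro l
    have hpx := hp_pos x (y 0)
    have hpx0 := hp_pos x₀ (y 0)
    have hZ0 := hZ 0
    have hr0 := hr 0
    have hγ : Real.exp (gammaExt (trueParam νX p x₀ y r θ₀) l)
        = r l * condDensity νX p (y l) x₀ / (r 0 * condDensity νX p (y 0) x₀) := by
      refine Fin.cases ?_ (fun j => ?_) l
      · have : r 0 * condDensity νX p (y 0) x₀ ≠ 0 := (mul_pos hr0 (hq 0 x₀)).ne'
        simp [gammaExt, div_self this]
      · simp only [gammaExt, Fin.cons_succ, trueParam, Sum.elim_inr]
        exact Real.exp_log (div_pos (mul_pos (hr _) (hq _ _)) (mul_pos (hr _) (hq _ _)))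
    have hl := hp_pos x₀ (y l)
    have hlx := hp_pos x (y l)
    have hZl := hZ l
    rw [Real.exp_add, hγ, ← hOR, logOddsRatio, Real.exp_log (by positivity)]
    simp only [condDensity]
    field_simp
  have h0 : 0 < r 0 * condDensity νX p (y 0) x := mul_pos (hr 0) (hq 0 x)
  have hs : 0 < ∑ l, r l * condDensity νX p (y l) x :=
    Finset.sum_pos (fun l _ => mul_pos (hr l) (hq l x)) Finset.univ_nonempty
  rw [exp_logProb, thetaPart_trueParam]
  simp_rw [hη]
  rw [← Finset.sum_div, div_div_div_cancel_right₀ h0.ne', mul_div_cancel₀ _ hs.ne']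

end

/-! ### Score and information -/

section

variable {ΩX ΩY : Type*} [MeasurableSpace ΩX] {S K : ℕ} {ψ : Theta S → ΩX → ΩY → ℝ}
  {y : Fin (K + 1) → ΩY} {r : Fin (K + 1) → ℝ} {Q : Fin (K + 1) → Measure ΩX} {lam₀ : Param S K}

lemma sum_mul_integral_score_eq_zero (hψ : ∀ x k, ContDiff ℝ 3 fun θ => ψ θ x (y k))
    (hpost : IsPosterior r Q fun k x => Real.exp (logProb ψ y k x lam₀))
    {s : Fin S ⊕ Fin K} (h_score : ∀ k, Integrable (fun x => pderiv s (logProb ψ y k x) lam₀) (Q k)) :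
    ∑ k, r k * ∫ x, pderiv s (logProb ψ y k x) lam₀ ∂(Q k) = 0 := by
  rw [hpost (fun k x => pderiv s (logProb ψ y k x) lam₀) (fun _ _ => 0) h_score
    (fun k => integrable_zero _ _ _) fun x => ?_]
  · simp
  · simpa using sum_exp_mul_pderiv_logProb (hψ x) s lam₀

/-- Second Bartlett identity for the averaged information matrix. -/
lemma avgInfo_apply_eq (hψ : ∀ x k, ContDiff ℝ 3 fun θ => ψ θ x (y k))
    (hpost : IsPosterior r Q fun k x => Real.exp (logProb ψ y k x lam₀))
    (h_score : ∀ k s, MemLp (fun x => pderiv s (logProb ψ y k x) lam₀) 2 (Q k))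
    (h_hess : ∀ k s t, Integrable (fun x => negHess (logProb ψ y k x) lam₀ s t) (Q k))
    (s t : Fin S ⊕ Fin K) :
    avgInfo ψ y r Q lam₀ s t = ∑ k, r k * ∫ x, pderiv s (logProb ψ y k x) lam₀ *
      pderiv t (logProb ψ y k x) lam₀ ∂(Q k) :=
  hpost _ _ (fun k => h_hess k s t) (fun k => (h_score k s).integrable_mul (h_score k t))
    fun x => sum_exp_mul_negHess_logProb (hψ x) s t lam₀

/-- The columns of the information matrix that belong to `γ` are multiples of the mean scores of
the strata. -/
lemma avgInfo_apply_inr (hψ : ∀ x k, ContDiff ℝ 3 fun θ => ψ θ x (y k))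
    (hpost : IsPosterior r Q fun k x => Real.exp (logProb ψ y k x lam₀))
    (h_score : ∀ k s, Integrable (fun x => pderiv s (logProb ψ y k x) lam₀) (Q k))
    (h_hess : ∀ k s t, Integrable (fun x => negHess (logProb ψ y k x) lam₀ s t) (Q k))
    (s : Fin S ⊕ Fin K) (j : Fin K) :
    avgInfo ψ y r Q lam₀ s (Sum.inr j)
      = r j.succ * ∫ x, pderiv s (logProb ψ y j.succ x) lam₀ ∂(Q j.succ) := by
  have h := hpost (fun k x => negHess (logProb ψ y k x) lam₀ s (Sum.inr j))
    (fun k x => if k = j.succ then pderiv s (logProb ψ y k x) lam₀ else 0)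
    (fun k => h_hess k s _) (fun k => ?_) fun x => ?_
  · rw [avgInfo, Matrix.of_apply, h, Finset.sum_eq_single j.succ]
    · simp
    · intro k _ hk
      simp [hk]
    · simp
  · by_cases hk : k = j.succ
    · simpa [hk] using h_score j.succ s
    · simp [hk]
  · simp_rw [negHess_inr_logProb (hψ x), ← Finset.sum_mul, sum_exp_logProb, one_mul, mul_ite,
      mul_zero]
    simp

/-- The mean score of each stratum is the image under the information matrix of a vector supported
on the `γ`-coordinates. For the reference stratum, which has no coordinate of its own, this comes
from the vanishing of the pooled mean score. -/
lemma exists_avgInfo_mulVec_eq_mean_score (hψ : ∀ x k, ContDiff ℝ 3 fun θ => ψ θ x (y k))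
    (hr : ∀ k, 0 < r k) (hpost : IsPosterior r Q fun k x => Real.exp (logProb ψ y k x lam₀))
    (h_score : ∀ k s, Integrable (fun x => pderiv s (logProb ψ y k x) lam₀) (Q k))
    (h_hess : ∀ k s t, Integrable (fun x => negHess (logProb ψ y k x) lam₀ s t) (Q k))
    (k : Fin (K + 1)) :
    ∃ b : Fin S ⊕ Fin K → ℝ, (∀ s, b (Sum.inl s) = 0) ∧
      (avgInfo ψ y r Q lam₀).mulVec b = fun s => ∫ x, pderiv s (logProb ψ y k x) lam₀ ∂(Q k) := by
  have hinr := avgInfo_apply_inr hψ hpost h_score h_hess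
  induction k using Fin.cases with
  | zero =>
    refine ⟨Sum.elim 0 fun _ => -(r 0)⁻¹, fun s => rfl, funext fun s => ?_⟩
    have h0 := sum_mul_integral_score_eq_zero hψ hpost (s := s) fun k => h_score k s
    rw [Fin.sum_univ_succ] at h0
    have hr0 := (hr 0).ne'
    simp only [Matrix.mulVec, dotProduct, Fintype.sum_sum_type, Sum.elim_inl, Pi.zero_apply,
      mul_zero, Finset.sum_const_zero, zero_add, Sum.elim_inr, hinr, ← Finset.sum_mul]
    field_simp
    linarith
  | succ j =>
    refine ⟨Pi.single (Sum.inr j) (r j.succ)⁻¹, fun s => by simp, funext fun s => ?_⟩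
    have hrj := (hr j.succ).ne'
    rw [Matrix.mulVec_single]
    simp only [MulOpposite.smul_eq_mul_unop, Pi.smul_apply, Matrix.col_apply, hinr,
      MulOpposite.unop_op]
    field_simp

/-- The covariance of the score falls short of the information by the between-strata covariance of
the mean scores. -/
lemma avgCov_eq_avgInfo_sub [∀ k, IsProbabilityMeasure (Q k)]
    (hψ : ∀ x k, ContDiff ℝ 3 fun θ => ψ θ x (y k))
    (hpost : IsPosterior r Q fun k x => Real.exp (logProb ψ y k x lam₀))
    (h_score : ∀ k s, MemLp (fun x => pderiv s (logProb ψ y k x) lam₀) 2 (Q k))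
    (h_hess : ∀ k s t, Integrable (fun x => negHess (logProb ψ y k x) lam₀ s t) (Q k)) :
    avgCov ψ y r Q lam₀ = avgInfo ψ y r Q lam₀ - ∑ k, r k • Matrix.vecMulVec
      (fun s => ∫ x, pderiv s (logProb ψ y k x) lam₀ ∂(Q k))
      (fun s => ∫ x, pderiv s (logProb ψ y k x) lam₀ ∂(Q k)) := by
  ext s t
  rw [Matrix.sub_apply, avgInfo_apply_eq hψ hpost h_score h_hess, Matrix.sum_apply,
    ← Finset.sum_sub_distrib, avgCov, Matrix.of_apply]
  refine Finset.sum_congr rfl fun k _ => ?_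
  rw [covariance_eq_sub (h_score k s) (h_score k t)]
  simp only [Matrix.smul_apply, Matrix.vecMulVec_apply, smul_eq_mul, mul_sub, Pi.mul_apply]

/-- In the sandwich matrix `I⁻¹ Σ I⁻¹`, the correction for the between-strata covariance lives on
the `γ`-block, so the `θ`-block agrees with that of `I⁻¹`. -/
lemma toBlocks₁₁_inv_mul_avgCov_mul_inv [∀ k, IsProbabilityMeasure (Q k)]
    (hψ : ∀ x k, ContDiff ℝ 3 fun θ => ψ θ x (y k)) (hr : ∀ k, 0 < r k)
    (hpost : IsPosterior r Q fun k x => Real.exp (logProb ψ y k x lam₀))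
    (h_score : ∀ k s, MemLp (fun x => pderiv s (logProb ψ y k x) lam₀) 2 (Q k))
    (h_hess : ∀ k s t, Integrable (fun x => negHess (logProb ψ y k x) lam₀ s t) (Q k))
    (hI : (avgInfo ψ y r Q lam₀).PosDef) :
    ((avgInfo ψ y r Q lam₀)⁻¹ * avgCov ψ y r Q lam₀ * (avgInfo ψ y r Q lam₀)⁻¹).toBlocks₁₁
      = (avgInfo ψ y r Q lam₀)⁻¹.toBlocks₁₁ := by
  choose b hb0 hb using exists_avgInfo_mulVec_eq_mean_score hψ hr hpost
    (fun k s => (h_score k s).integrable (by norm_num)) h_hess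
  rw [avgCov_eq_avgInfo_sub hψ hpost h_score h_hess]
  simp_rw [← hb]
  set A := avgInfo ψ y r Q lam₀ with hA
  have hdet : IsUnit A.det := (Matrix.isUnit_iff_isUnit_det A).1 hI.isUnit
  have hsymm : A.transpose = A := by simpa using hI.isHermitian.eq
  have hb1 : ∀ k, A⁻¹.mulVec (A.mulVec (b k)) = b k := fun k => by
    rw [Matrix.mulVec_mulVec, Matrix.nonsing_inv_mul _ hdet, Matrix.one_mulVec]
  have hb2 : ∀ k, Matrix.vecMul (A.mulVec (b k)) A⁻¹ = b k := fun k => by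
    rw [← Matrix.mulVec_transpose, Matrix.transpose_nonsing_inv, hsymm, hb1]
  rw [mul_sub, sub_mul, Matrix.nonsing_inv_mul _ hdet, one_mul, Finset.mul_sum, Finset.sum_mul]
  simp_rw [Matrix.mul_smul, Matrix.smul_mul, Matrix.mul_vecMulVec, Matrix.vecMulVec_mul, hb1, hb2]
  ext s t
  simp [Matrix.toBlocks₁₁, Matrix.sum_apply, Matrix.vecMulVec_apply, hb0]

end

/-! ### Asymptotic normality -/

lemma isProbabilityMeasure_of_hasLaw {Ω E : Type*} [MeasurableSpace Ω] [MeasurableSpace E]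
    {μ : Measure Ω} [IsProbabilityMeasure μ] {Q : Measure E} {X : Ω → E} (h : HasLaw X Q μ) :
    IsProbabilityMeasure Q := by
  rw [← h.map_eq]
  exact Measure.isProbabilityMeasure_map h.aemeasurable

lemma integral_pos_of_isProbabilityMeasure_condLaw {ΩX ΩY : Type*} [MeasurableSpace ΩX]
    {νX : Measure ΩX} {p : ΩX → ΩY → ℝ} (hp_pos : ∀ x y, 0 < p x y) (y : ΩY)
    [IsProbabilityMeasure (condLaw νX p y)] : 0 < ∫ x, p x y ∂νX := by
  refine (integral_nonneg fun x => (hp_pos x y).le).lt_of_ne' fun h => ?_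
  refine IsProbabilityMeasure.ne_zero (condLaw νX p y) ?_
  simp [condLaw, condDensity, h]

lemma thetaPart_eq_mulVec {S K : ℕ} (v : Param S K) :
    thetaPart v = WithLp.toLp 2
      (((1 : Matrix (Fin S ⊕ Fin K) (Fin S ⊕ Fin K) ℝ).submatrix Sum.inl id).mulVec v.ofLp) := by
  ext s
  simp [thetaPart, Matrix.mulVec, dotProduct, Matrix.one_apply]

lemma thetaPart_smul_sub {S K : ℕ} (c : ℝ) (v w : Param S K) :
    thetaPart (c • (v - w)) = c • (thetaPart v - thetaPart w) := by
  ext s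
  simp [thetaPart]

lemma submatrix_mul_mul_transpose {S K : ℕ} (C : Matrix (Fin S ⊕ Fin K) (Fin S ⊕ Fin K) ℝ) :
    (1 : Matrix (Fin S ⊕ Fin K) (Fin S ⊕ Fin K) ℝ).submatrix Sum.inl id * C *
      ((1 : Matrix (Fin S ⊕ Fin K) (Fin S ⊕ Fin K) ℝ).submatrix Sum.inl id).transpose
      = C.toBlocks₁₁ := by
  ext s t
  simp [Matrix.mul_apply, Matrix.one_apply, Matrix.toBlocks₁₁]

/-- The linearized estimating equation: the averaged Hessian between `λ₀` and `λ₁`, applied to the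
rescaled estimation error, is the difference of the rescaled scores. For an empty sample both sides
vanish, in accordance with `(√0)⁻¹ = 0`. -/
lemma toEuclideanCLM_average_negHess {S K : ℕ} {f : Param S K → ℝ} (hf : ContDiff ℝ 2 f)
    (n : ℕ) (lam₀ lam₁ : Param S K) :
    Matrix.toEuclideanCLM (𝕜 := ℝ) (Matrix.of fun t s => (n : ℝ)⁻¹ *
        ∫ u in (0 : ℝ)..1, negHess f (lam₀ + u • (lam₁ - lam₀)) s t) (√(n : ℝ) • (lam₁ - lam₀))
      = (√(n : ℝ))⁻¹ • grad f lam₀ + -((√(n : ℝ))⁻¹ • grad f lam₁) := by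
  have hM : (Matrix.of fun t s => (n : ℝ)⁻¹ *
        ∫ u in (0 : ℝ)..1, negHess f (lam₀ + u • (lam₁ - lam₀)) s t)
      = (n : ℝ)⁻¹ • (Matrix.of fun s t =>
        ∫ u in (0 : ℝ)..1, negHess f (lam₀ + u • (lam₁ - lam₀)) s t).transpose := by
    ext s t
    simp
  have hn : √(n : ℝ) * (n : ℝ)⁻¹ = (√(n : ℝ))⁻¹ := by
    rcases Nat.eq_zero_or_pos n with rfl | h
    · simp
    · have h' : (0 : ℝ) < n := by exact_mod_cast h
      have hs : √(n : ℝ) ≠ 0 := (Real.sqrt_pos.2 h').ne'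
      field_simp
      exact Real.sq_sqrt h'.le
  refine WithLp.ofLp_injective 2 ?_
  rw [Matrix.ofLp_toEuclideanCLM, hM, WithLp.ofLp_smul, Matrix.mulVec_smul, Matrix.smul_mulVec,
    grad_sub_grad hf, smul_smul, hn, ← smul_neg, ← smul_add, ← sub_eq_add_neg, WithLp.ofLp_smul]

end OddsRatio

theorem theorem5
    {ΩX ΩY Ω : Type*} [MeasurableSpace ΩX] [MeasurableSpace ΩY] [MeasurableSpace Ω]
    {dX dY S K : ℕ}
    -- the association model
    (hX : ΩX → EuclideanSpace ℝ (Fin dX)) (hY : ΩY → EuclideanSpace ℝ (Fin dY))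
    (G : EuclideanSpace ℝ (Fin dX) → EuclideanSpace ℝ (Fin dY) → Theta S → ℝ)
    (x₀ : ΩX) (y : Fin (K + 1) → ΩY) (hy : Function.Injective y)
    (hG : IsAssociationModel hX hY G x₀ (y 0))
    -- the joint distribution of X and Y, with a positive density and true parameter θ₀
    (νX : Measure ΩX) (νY : Measure ΩY) [SigmaFinite νX] [SigmaFinite νY]
    (P : Measure (ΩX × ΩY)) [IsProbabilityMeasure P]
    (p : ΩX → ΩY → ℝ) (hp_meas : Measurable (fun q : ΩX × ΩY => p q.1 q.2))
    (hp_pos : ∀ x y', 0 < p x y')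
    (hP : P = (νX.prod νY).withDensity (fun q => ENNReal.ofReal (p q.1 q.2)))
    (hp_int : ∀ k, Integrable (fun x => p x (y k)) νX)
    (θ₀ : Theta S)
    (hOR : ∀ x y', logOddsRatio p x₀ (y 0) x y' = psi hX hY G θ₀ x y')
    -- sampling conditional on Y, with fixed ratios of the subsample sizes
    (r : Fin (K + 1) → ℝ) (hr : ∀ k, 0 < r k)
    (N : ℕ → Fin (K + 1) → ℕ)
    (hN : ∀ m k, (N m k : ℝ) = r k * ((∑ l, N m l : ℕ) : ℝ))
    (hN_top : Tendsto (fun m => ∑ l, N m l) atTop atTop)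
    (μ : Measure Ω) [IsProbabilityMeasure μ]
    (X : Fin (K + 1) → ℕ → Ω → ΩX)
    (hX_law : ∀ k i, HasLaw (X k i) (condLaw νX p (y k)) μ)
    (hX_indep : iIndepFun (fun q : Fin (K + 1) × ℕ => X q.1 q.2) μ)
    -- the true compound parameter
    (lam₀ : Param S K) (hlam₀ : lam₀ = trueParam νX p x₀ y r θ₀)
    -- the covariances and expectations at the true parameter exist
    (h_score : ∀ k s, MemLp (fun x => pderiv s (logProb (psi hX hY G) y k x) lam₀) 2
      (condLaw νX p (y k)))
    (h_hess : ∀ k s t, Integrable (fun x => negHess (logProb (psi hX hY G) y k x) lam₀ s t)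
      (condLaw νX p (y k)))
    (Ibar Sbar : Matrix (Fin S ⊕ Fin K) (Fin S ⊕ Fin K) ℝ)
    (hIbar : Ibar = avgInfo (psi hX hY G) y r (fun k => condLaw νX p (y k)) lam₀)
    (hSbar : Sbar = avgCov (psi hX hY G) y r (fun k => condLaw νX p (y k)) lam₀)
    (hI_pos : Ibar.PosDef)
    -- the estimators
    (lamHat : ℕ → Ω → Param S K) (h_meas : ∀ m, Measurable (lamHat m))
    (hN1 : TendstoInMeasure μ
      (fun m ω => (√((∑ l, N m l : ℕ) : ℝ))⁻¹ •
        grad (logLik (psi hX hY G) y (N m) (fun k i => X k i ω)) (lamHat m ω))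
      atTop (fun _ => 0))
    (hN2 : TendstoInMeasure μ lamHat atTop (fun _ => lam₀))
    (hN3 : ∀ s t, TendstoInMeasure μ
      (fun m ω => ((∑ l, N m l : ℕ) : ℝ)⁻¹ *
        ∫ u in (0 : ℝ)..1, negHess (logLik (psi hX hY G) y (N m) (fun k i => X k i ω))
          (lam₀ + u • (lamHat m ω - lam₀)) s t)
      atTop (fun _ => Ibar s t)) :
    ((Ibar⁻¹ * Sbar * Ibar⁻¹).PosSemidef ∧
      TendstoInDistribution
        (fun m ω => √((∑ l, N m l : ℕ) : ℝ) • (lamHat m ω - lam₀)) atTop id (fun _ => μ)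
        (multivariateGaussian 0 (Ibar⁻¹ * Sbar * Ibar⁻¹))) ∧
    ((Ibar⁻¹).toBlocks₁₁.PosSemidef ∧
      TendstoInDistribution
        (fun m ω => √((∑ l, N m l : ℕ) : ℝ) • (thetaPart (lamHat m ω) - θ₀)) atTop id (fun _ => μ)
        (multivariateGaussian 0 (Ibar⁻¹).toBlocks₁₁)) := by
  have hψ : ∀ x k, ContDiff ℝ 3 fun θ => psi hX hY G θ x (y k) :=
    fun x k => hG.contDiff _ ⟨x, rfl⟩ _ ⟨y k, rfl⟩
  have hQ : ∀ k, IsProbabilityMeasure (condLaw νX p (y k)) :=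
    fun k => isProbabilityMeasure_of_hasLaw (hX_law k 0)
  have hZ : ∀ k, 0 < ∫ x, p x (y k) ∂νX :=
    fun k => integral_pos_of_isProbabilityMeasure_condLaw hp_pos (y k)
  have hq_meas : ∀ k, Measurable (condDensity νX p (y k)) := fun k =>
    (hp_meas.comp (measurable_id.prodMk measurable_const)).div_const _
  have hpost : IsPosterior r (fun k => condLaw νX p (y k))
      fun k x => Real.exp (logProb (psi hX hY G) y k x lam₀) := by
    rw [hlam₀]
    exact isPosterior_withDensity hq_meas
      (fun k x => div_nonneg (hp_pos _ _).le (hZ k).le)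
      fun k x => mul_condDensity_eq hp_pos hZ hr hOR k x
  have hblock := toBlocks₁₁_inv_mul_avgCov_mul_inv hψ hr hpost h_score h_hess (hIbar ▸ hI_pos)
  rw [← hIbar, ← hSbar] at hblock
  -- The covariance matrix of the score is the pooled covariance matrix of the central limit theorem.
  have hS : Sbar = pooledCov r (fun k => condLaw νX p (y k))
      fun k x => grad (logProb (psi hX hY G) y k x) lam₀ := hSbar
  have hSpos : Sbar.PosSemidef := hS ▸ posSemidef_pooledCov (fun k => (hr k).le) h_score
  have hdet : IsUnit Ibar.det := (Matrix.isUnit_iff_isUnit_det _).1 hI_pos.isUnit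
  have hsymm : Ibar.transpose = Ibar := by simpa using hI_pos.isHermitian.eq
  have hsymm' : (Ibar⁻¹).transpose = Ibar⁻¹ := by rw [Matrix.transpose_nonsing_inv, hsymm]
  have hCpos : (Ibar⁻¹ * Sbar * Ibar⁻¹).PosSemidef := by
    have := hSpos.mul_mul_conjTranspose_same Ibar⁻¹
    rwa [Matrix.conjTranspose_eq_transpose_of_trivial, hsymm'] at this
  -- Central limit theorem for the score at the true parameter.
  have hU : TendstoInDistribution (fun m ω => (√((∑ l, N m l : ℕ) : ℝ))⁻¹ •
      grad (logLik (psi hX hY G) y (N m) (fun k i => X k i ω)) lam₀) atTop id (fun _ => μ)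
      (multivariateGaussian 0 Sbar) := by
    simp_rw [grad_logLik hψ]
    rw [hS]
    exact tendstoInDistribution_stratified_sum
      (φ := fun k x => grad (logProb (psi hX hY G) y k x) lam₀) hr h_score
      (fun s => sum_mul_integral_score_eq_zero hψ hpost
        fun k => (h_score k s).integrable (by norm_num)) hX_law hX_indep hN hN_top
  have hA := tendstoInMeasure_toEuclideanCLM (μ := μ) (M₀ := Ibar)
    (M := fun m ω => Matrix.of fun t s => ((∑ l, N m l : ℕ) : ℝ)⁻¹ *
      ∫ u in (0 : ℝ)..1, negHess (logLik (psi hX hY G) y (N m) (fun k i => X k i ω))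
        (lam₀ + u • (lamHat m ω - lam₀)) s t)
    fun t s => by
      have := hN3 s t
      rwa [← Matrix.transpose_apply Ibar, hsymm] at this
  have hR : TendstoInMeasure μ (fun m ω => -((√((∑ l, N m l : ℕ) : ℝ))⁻¹ •
      grad (logLik (psi hX hY G) y (N m) (fun k i => X k i ω)) (lamHat m ω))) atTop
      (fun _ => 0) := by
    rw [tendstoInMeasure_iff_norm] at hN1 ⊢
    simpa only [sub_zero, norm_neg] using hN1
  have hdiff := tendstoInMeasure_sub_of_perturbed_equation
    (W := fun m ω => √((∑ l, N m l : ℕ) : ℝ) • (lamHat m ω - lam₀))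
    (B := Matrix.toEuclideanCLM (𝕜 := ℝ) Ibar⁻¹)
    (fun v => by
      rw [← mul_apply_eq_comp, ← map_mul, Matrix.nonsing_inv_mul _ hdet, map_one,
        one_apply_eq_self])
    hU hR hA fun m ω => toEuclideanCLM_average_negHess
      ((contDiff_logLik hψ (N m) fun k i => X k i ω).of_le (by norm_num)) _ _ _
  have hBU := TendstoInDistribution.mulVec_multivariateGaussian hSpos hU Ibar⁻¹
  rw [hsymm'] at hBU
  have hW : TendstoInDistribution
      (fun m ω => √((∑ l, N m l : ℕ) : ℝ) • (lamHat m ω - lam₀)) atTop id (fun _ => μ)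
      (multivariateGaussian 0 (Ibar⁻¹ * Sbar * Ibar⁻¹)) :=
    tendstoInDistribution_of_tendstoInMeasure_sub _ _ hBU hdiff
      fun m => (((h_meas m).sub_const _).fun_const_smul _).aemeasurable
  refine ⟨⟨hCpos, hW⟩, ?_, ?_⟩
  · exact hI_pos.inv.posSemidef.submatrix Sum.inl
  · have hθ := TendstoInDistribution.mulVec_multivariateGaussian hCpos hW
      ((1 : Matrix (Fin S ⊕ Fin K) (Fin S ⊕ Fin K) ℝ).submatrix Sum.inl id)
    rw [submatrix_mul_mul_transpose, hblock] at hθ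
    have h0 : thetaPart lam₀ = θ₀ := by rw [hlam₀, thetaPart_trueParam]
    simpa only [← thetaPart_eq_mulVec, thetaPart_smul_sub, h0] using hθ
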